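/- Let $m,n$ be positive integers and let $\{X_t\}_{t\ge 0}$ be an $m\times n$ matrix-valued process generated by an ECC-MAR model with left and right cointegration ranks $(r_1,r_2)$, $0<r_1<m$, $0<r_2<n$: \[ X_t-X_{t-1}=\tau\gamma'X_{t-1}+X_{t-1}\theta\varphi'+\tau\gamma'X_{t-1}\theta\varphi'+E_t,\qquad t\ge 1, \] where $X_0$ is an arbitrary random matrix, $\tau,\gamma\in\mathbb R^{m\times r_1}$ and $\varphi,\theta\in\mathbb R^{n\times r_2}$ have full column rank, and $\{E_t\}_{t\ge1}$ is white noise (square integrable, mean zero, uncorrelated over time) such that $\operatorname{vec}(E_t)$ has a covariance matrix that is positive definite and does not depend on $t$. Assume that $\Lambda=I_m+\tau\gamma'$ has $1$ as a semisimple eigenvalue of multiplicity $m-r_1$, that $\Psi=I_n+\varphi\theta'$ has $1$ as a semisimple eigenvalue of multiplicity $n-r_2$, and that all other (complex) eigenvalues of $\Lambda$ and $\Psi$ have modulus strictly less than $1$. (The cointegration spaces are the column spaces of $\gamma$ and $\theta$, of dimensions $r_1$ and $r_2$.) A scalar process $\{Y_t\}_{t\ge0}$ is called $I(0)$ if it is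 square integrable and covariance stationary up to the effect of its initial value, i.e. $\mathbb E Y_t$ and, for every $h\ge0$, $\operatorname{Cov}(Y_t,Y_{t+h})$ converge to finite limits as $t\to\infty$. Let $r=nr_1+mr_2-r_1r_2$ and let $(r_1^*,r_2^*)\neq(r_1,r_2)$ be a pair of non-negative integers satisfying the same rank identity $r=nr_1^*+mr_2^*-r_1^*r_2^*$. Then at least one of the following holds: \begin{enumerate} \item for every $\gamma^*\in\mathbb R^{m\times r_1^*}$ of full column rank, not all components of $\gamma^{*\prime}X_t$ are $I(0)$; \item for every $\theta^*\in\mathbb R^{n\times r_2^*}$ of full column rank, not all components of $X_t\theta^*$ are $I(0)$. \end{enumerate} -/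

import Mathlib

open MeasureTheory ProbabilityTheory Filter Topology Matrix

/-- `E` is an `m × n` matrix white noise with covariance matrix `S`: the entries are square
integrable and centred, different dates are uncorrelated, and at every date the covariance matrix
of the vectorization `vec (E t)` (columns stacked, so indexed by column and row) is `S`. -/
structure IsMatrixWhiteNoise {Ω : Type*} [MeasurableSpace Ω] {m n : ℕ} (μ : Measure Ω)
    (E : ℕ → Ω → Matrix (Fin m) (Fin n) ℝ)
    (S : Matrix (Fin n × Fin m) (Fin n × Fin m) ℝ) : Prop where
  measurable : ∀ t i j, Measurable (fun ω => E t ω i j)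
  memLp : ∀ t i j, MemLp (fun ω => E t ω i j) 2 μ
  mean_zero : ∀ t i j, ∫ ω, E t ω i j ∂μ = 0
  cov_same : ∀ t a b,
    covariance (fun ω => vec (E t ω) a) (fun ω => vec (E t ω) b) μ = S a b
  cov_ne : ∀ s t, s ≠ t → ∀ a b,
    covariance (fun ω => vec (E s ω) a) (fun ω => vec (E t ω) b) μ = 0

/-- The eigenvalue `1` of the real `d × d` matrix `A` is semisimple (its geometric multiplicity
is its algebraic one) with multiplicity `d - k`, where `0 < k < d`, and every other complex
eigenvalue of `A` lies strictly inside the unit disk. -/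
structure HasStableUnitRoot {d : ℕ} (A : Matrix (Fin d) (Fin d) ℝ) (k : ℕ) : Prop where
  pos : 0 < k
  lt : k < d
  algebraic : A.charpoly.rootMultiplicity 1 = d - k
  semisimple : Module.finrank ℝ (Module.End.eigenspace (toLin' A) 1) =
    A.charpoly.rootMultiplicity 1
  stable : ∀ z ∈ spectrum ℂ (A.map (algebraMap ℝ ℂ)), z ≠ 1 → ‖z‖ < 1

/-- `X` is an ECC-MAR process, started at an arbitrary random matrix `X 0`, with left and right
cointegration ranks `(r₁, r₂)`, row and column cointegration matrices `γ`, `θ`, adjustment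
matrices `τ`, `φ`, and innovations `E 1, E 2, …`, white noise with covariance matrix `S`.
The cointegration spaces are the column spaces of `γ` and `θ`, of dimension `r₁` and `r₂`.
In levels, `X (t+1) = Λ * X t * Ψᵀ + E (t+1)` with `Λ = 1 + τ * γᵀ` and `Ψ = 1 + φ * θᵀ`. -/
structure IsECCMAR {Ω : Type*} [MeasurableSpace Ω] {m n r₁ r₂ : ℕ} (μ : Measure Ω)
    (τ γ : Matrix (Fin m) (Fin r₁) ℝ) (φ θ : Matrix (Fin n) (Fin r₂) ℝ)
    (S : Matrix (Fin n × Fin m) (Fin n × Fin m) ℝ)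
    (X E : ℕ → Ω → Matrix (Fin m) (Fin n) ℝ) : Prop where
  rank_τ : τ.rank = r₁
  rank_γ : γ.rank = r₁
  rank_φ : φ.rank = r₂
  rank_θ : θ.rank = r₂
  row_roots : HasStableUnitRoot (1 + τ * γᵀ) r₁
  col_roots : HasStableUnitRoot (1 + φ * θᵀ) r₂
  noise : IsMatrixWhiteNoise μ (fun t => E (t + 1)) S
  measurable : ∀ t i j, Measurable (fun ω => X t ω i j)
  error_correction : ∀ t, ∀ᵐ ω ∂μ,
    X (t + 1) ω - X t ω =
      τ * γᵀ * X t ω + X t ω * θ * φᵀ + τ * γᵀ * X t ω * θ * φᵀ + E (t + 1) ω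

/-- A scalar process is `I(0)`, in the sense "integrated of order zero = stationary": it is of
second order and covariance stationary up to a transient caused by the initial value, that is,
its means and its autocovariances at every lag converge as time goes to infinity.
Exactly covariance stationary processes qualify, and so do stable autoregressions started at any
square integrable value. No condition on the long-run variance or on summability of the
autocovariances is imposed; stricter readings of `I(0)` that add one imply this one, so failing
to be `I(0)` in this sense is the strongest form of non-stationarity. -/
structure IsIZero {Ω : Type*} [MeasurableSpace Ω] (μ : Measure Ω) (Y : ℕ → Ω → ℝ) : Prop where
  memLp : ∀ t, MemLp (Y t) 2 μ
  mean : ∃ c : ℝ, Tendsto (fun t => ∫ ω, Y t ω ∂μ) atTop (𝓝 c)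
  autocov : ∀ h : ℕ, ∃ κ : ℝ, Tendsto (fun t => covariance (Y t) (Y (t + h)) μ) atTop (𝓝 κ)

/-- A matrix-valued process is componentwise `I(0)`. -/
def IsIZeroComponentwise {Ω : Type*} [MeasurableSpace Ω] {p q : ℕ} (μ : Measure Ω)
    (Y : ℕ → Ω → Matrix (Fin p) (Fin q) ℝ) : Prop :=
  ∀ i j, IsIZero μ (fun t ω => Y t ω i j)

/-! ### Matrices with a stable unit root are power bounded -/

section LinearAlgebra

/-! The rank identity fixes `(m - r₁)(n - r₂) = mn - r`, so a different pair with the same `r` must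
exceed `(r₁, r₂)` in some coordinate. Say `s₁ > r₁`. A full-rank `δ` with `s₁` columns then has a
column `v` with `v ⬝ᵥ u ≠ 0` for some `u` in the kernel of `γᵀ`. For `w ≠ 0` with `φᵀ w = 0`, the
vector `X_t w` is an autoregression with matrix `Λ = 1 + τγᵀ`, and `Λu = u`. Solving it, `vᵀ X_t w`
is `vᵀ Λ^t X_0 w` plus a sum of `t` uncorrelated noise terms. The coefficient of each has the same
nonzero pairing with `w ⊗ u`, so positive definiteness of `S` bounds its variance below and the
total grows linearly (`not_isL2Bounded_sum`). The initial term stays bounded because `Λ` is power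
bounded, while `I(0)` forces bounded second moments: a contradiction. The other side is symmetric.
-/

theorem exists_norm_pow_le_of_spectrum_lt_one {A : Type*} [NormedRing A] [NormedAlgebra ℂ A]
    [CompleteSpace A] [Nontrivial A] (a : A) (h : ∀ z ∈ spectrum ℂ a, ‖z‖ < 1) :
    ∃ C : ℝ, ∀ k : ℕ, ‖a ^ k‖ ≤ C := by
  have hlt : spectralRadius ℂ a < (1 : NNReal) :=
    spectrum.spectralRadius_lt_of_forall_lt a fun z hz => by
      rw [← NNReal.coe_lt_coe]; simpa using h z hz
  -- Gelfand's formula: `‖a ^ k‖ ^ (1 / k)` is eventually below `1`, hence so is `‖a ^ k‖`.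
  have hev := (spectrum.pow_nnnorm_pow_one_div_tendsto_nhds_spectralRadius a).eventually_lt_const hlt
  have hb : IsBoundedUnder (· ≤ ·) atTop fun k : ℕ => ‖a ^ k‖ := by
    refine ⟨1, ?_⟩
    rw [eventually_map]
    filter_upwards [hev, eventually_gt_atTop 0] with k hk hk0
    have hk0' : (0 : ℝ) < 1 / k := by positivity
    by_contra! hgt
    refine absurd hk (not_lt.mpr ?_)
    have : (1 : ENNReal) ≤ ‖a ^ k‖₊ := by
      rw [← ENNReal.coe_one, ENNReal.coe_le_coe, ← NNReal.coe_le_coe]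
      simpa using hgt.le
    simpa using ENNReal.one_le_rpow this hk0'
  obtain ⟨C, hC⟩ := hb.bddAbove_range
  exact ⟨C, fun k => hC ⟨k, rfl⟩⟩

theorem Matrix.exists_abs_pow_apply_le {k : ℕ} (hk : 0 < k) (B : Matrix (Fin k) (Fin k) ℝ)
    (h : ∀ z ∈ spectrum ℂ (B.map (algebraMap ℝ ℂ)), ‖z‖ < 1) :
    ∃ C : ℝ, ∀ (t : ℕ) (i j : Fin k), |(B ^ t) i j| ≤ C := by
  let := Matrix.linftyOpNormedRing (n := Fin k) (α := ℂ)
  let := Matrix.linftyOpNormedAlgebra (n := Fin k) (R := ℂ) (α := ℂ)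
  have : Nonempty (Fin k) := ⟨⟨0, hk⟩⟩
  obtain ⟨C, hC⟩ := exists_norm_pow_le_of_spectrum_lt_one (B.map (algebraMap ℝ ℂ)) h
  refine ⟨C, fun t i j => le_trans ?_ (hC t)⟩
  have e : (B.map (algebraMap ℝ ℂ)) ^ t = (B ^ t).map (algebraMap ℝ ℂ) :=
    (map_pow (algebraMap ℝ ℂ).mapMatrix B t).symm
  rw [e]
  have h1 : |(B ^ t) i j| = ‖((B ^ t).map (algebraMap ℝ ℂ)) i j‖ := by simp
  rw [h1, Matrix.linfty_opNorm_def]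
  have h2 : ‖((B ^ t).map (algebraMap ℝ ℂ)) i j‖₊ ≤
      Finset.univ.sup fun i => ∑ j, ‖((B ^ t).map (algebraMap ℝ ℂ)) i j‖₊ :=
    (Finset.single_le_sum (f := fun j => ‖((B ^ t).map (algebraMap ℝ ℂ)) i j‖₊)
      (fun _ _ => zero_le) (Finset.mem_univ j)).trans
      (Finset.le_sup (f := fun i => ∑ j, ‖((B ^ t).map (algebraMap ℝ ℂ)) i j‖₊)
        (Finset.mem_univ i))
  exact_mod_cast h2

open Polynomial in
theorem Matrix.charpoly_one_add_mul {R : Type*} [CommRing R] {d k : ℕ} (hkd : k ≤ d)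
    (τ γ : Matrix (Fin d) (Fin k) R) :
    (1 + τ * γᵀ).charpoly = (X - 1) ^ (d - k) * (1 + γᵀ * τ).charpoly := by
  have key : ∀ {l : ℕ} (M : Matrix (Fin l) (Fin l) R),
      (1 + M).charpoly = M.charpoly.comp (X - 1) := fun M => by
    have := charpoly_sub_scalar M (-1)
    simpa [sub_eq_add_neg, add_comm] using this
  rw [key, key, charpoly_mul_comm_of_le _ _ (by simpa using hkd)]
  simp

/-- Powers reduce to those of the small matrix `B = 1 + γᵀτ`, whose spectrum is that of `Λ` with the
unit roots removed: `Λ^t = 1 + τ (γᵀτ)⁻¹ (B^t - 1) γᵀ`. -/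
theorem HasStableUnitRoot.exists_abs_pow_apply_le {d k : ℕ} {τ γ : Matrix (Fin d) (Fin k) ℝ}
    (h : HasStableUnitRoot (1 + τ * γᵀ) k) :
    ∃ C : ℝ, ∀ (t : ℕ) (i j : Fin d), |((1 + τ * γᵀ : Matrix (Fin d) (Fin d) ℝ) ^ t) i j| ≤ C := by
  set B : Matrix (Fin k) (Fin k) ℝ := 1 + γᵀ * τ with hB
  have hcp : (1 + τ * γᵀ).charpoly = (Polynomial.X - 1) ^ (d - k) * B.charpoly :=
    charpoly_one_add_mul h.lt.le τ γ
  -- The factor `(X - 1) ^ (d - k)` already exhausts the algebraic multiplicity of `1`.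
  have hB1 : ¬ B.charpoly.IsRoot 1 := by
    intro hr
    have hne : (Polynomial.X - 1) ^ (d - k) * B.charpoly ≠ 0 := hcp ▸ (charpoly_monic _).ne_zero
    have h1 := h.algebraic
    rw [hcp, Polynomial.rootMultiplicity_mul hne, ← Polynomial.C_1,
      Polynomial.rootMultiplicity_X_sub_C_pow] at h1
    have := (Polynomial.rootMultiplicity_pos (charpoly_monic B).ne_zero).mpr hr
    omega
  have hspec : ∀ z ∈ spectrum ℂ (B.map (algebraMap ℝ ℂ)), ‖z‖ < 1 := by
    intro z hz
    rw [mem_spectrum_iff_isRoot_charpoly, charpoly_map] at hz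
    refine h.stable z ?_ ?_
    · rw [mem_spectrum_iff_isRoot_charpoly, charpoly_map, hcp, Polynomial.map_mul]
      exact Polynomial.root_mul_left_of_isRoot _ hz
    · rintro rfl
      apply hB1
      have h2 : (algebraMap ℝ ℂ) (B.charpoly.eval 1) = 0 := by
        rw [← Polynomial.eval_map_apply]
        simpa using hz
      simpa using h2
  have hunit : IsUnit (γᵀ * τ) := by
    have h1 : (1 : ℝ) ∉ spectrum ℝ B := by rwa [mem_spectrum_iff_isRoot_charpoly]
    rw [spectrum.notMem_iff] at h1
    have : -(γᵀ * τ) = algebraMap ℝ _ 1 - B := by simp [hB]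
    rw [← IsUnit.neg_iff, this]
    exact h1
  obtain ⟨G, hG⟩ := hunit.exists_left_inv
  have hpow : ∀ t : ℕ, (1 + τ * γᵀ : Matrix (Fin d) (Fin d) ℝ) ^ t =
      1 + τ * G * (B ^ t - 1) * γᵀ := by
    intro t
    induction t with
    | zero => simp
    | succ t ih =>
      have h1 : γᵀ * (1 + τ * γᵀ) = B * γᵀ := by
        rw [hB, Matrix.mul_add, Matrix.add_mul, Matrix.mul_assoc]; simp
      have h2 : G * (B - 1) = 1 := by
        rw [hB, add_sub_cancel_left, hG]
      have h3 : τ * G * (B - 1) = τ := by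
        rw [Matrix.mul_assoc, h2, Matrix.mul_one]
      have h4 : B ^ (t + 1) - 1 = (B ^ t - 1) * B + (B - 1) := by
        rw [pow_succ]; noncomm_ring
      rw [pow_succ, ih, Matrix.add_mul 1, Matrix.one_mul, Matrix.mul_assoc _ γᵀ, h1, h4,
        Matrix.mul_add (τ * G), Matrix.add_mul (τ * G * _) _ γᵀ, h3]
      simp only [Matrix.mul_assoc]
      abel
  obtain ⟨C, hC⟩ := B.exists_abs_pow_apply_le h.pos hspec
  set P : Matrix (Fin d) (Fin k) ℝ := τ * G with hP
  refine ⟨1 + ∑ i : Fin d, ∑ j : Fin d, ∑ b, (∑ a, |P i a| * (C + 1)) * |γ j b|, fun t i j => ?_⟩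
  have hC0 : 0 ≤ C := (abs_nonneg _).trans (hC 0 ⟨0, h.pos⟩ ⟨0, h.pos⟩)
  have hone : ∀ {l : ℕ} (i j : Fin l), |(1 : Matrix (Fin l) (Fin l) ℝ) i j| ≤ 1 := by
    intro l i j
    rw [one_apply]; split_ifs <;> simp
  have hij : |(P * (B ^ t - 1) * γᵀ : Matrix (Fin d) (Fin d) ℝ) i j| ≤ ∑ b, (∑ a, |P i a| * (C + 1)) * |γ j b| := by
    rw [Matrix.mul_apply]
    refine (Finset.abs_sum_le_sum_abs _ _).trans (Finset.sum_le_sum fun b _ => ?_)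
    rw [abs_mul, transpose_apply]
    refine mul_le_mul_of_nonneg_right ?_ (abs_nonneg _)
    rw [Matrix.mul_apply]
    refine (Finset.abs_sum_le_sum_abs _ _).trans (Finset.sum_le_sum fun a _ => ?_)
    rw [abs_mul]
    refine mul_le_mul_of_nonneg_left ?_ (abs_nonneg _)
    rw [Matrix.sub_apply]
    exact (abs_sub _ _).trans (add_le_add (hC t a b) (hone a b))
  rw [hpow t, Matrix.add_apply]
  refine (abs_add_le _ _).trans (add_le_add (hone i j) (hij.trans ?_))
  have hnn : ∀ i j, 0 ≤ ∑ b, (∑ a, |P i a| * (C + 1)) * |γ j b| := fun i j => by positivity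
  exact (Finset.single_le_sum (f := fun j => ∑ b, (∑ a, |P i a| * (C + 1)) * |γ j b|)
    (fun j _ => hnn i j) (Finset.mem_univ j)).trans
    (Finset.single_le_sum (f := fun i => ∑ j, ∑ b, (∑ a, |P i a| * (C + 1)) * |γ j b|)
      (fun i _ => Finset.sum_nonneg fun j _ => hnn i j) (Finset.mem_univ i))

/-- Cauchy–Schwarz for the form `S`, applied to `p` and `y = S⁻¹ x`; the constant is `1 / (xᵀ S⁻¹
x)`. -/
theorem Matrix.PosDef.exists_mul_sq_dotProduct_le {ι : Type*} [Fintype ι] {S : Matrix ι ι ℝ}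
    (hS : S.PosDef) {x : ι → ℝ} (hx : x ≠ 0) :
    ∃ c > 0, ∀ p : ι → ℝ, c * (p ⬝ᵥ x) ^ 2 ≤ p ⬝ᵥ S *ᵥ p := by
  classical
  have hdet : IsUnit S.det := hS.det_pos.ne'.isUnit
  set y := S⁻¹ *ᵥ x with hy
  have hSy : S *ᵥ y = x := by rw [hy, mulVec_mulVec, mul_nonsing_inv _ hdet, one_mulVec]
  have hy0 : y ≠ 0 := by rintro h0; rw [h0, mulVec_zero] at hSy; exact hx hSy.symm
  have hpos : 0 < y ⬝ᵥ x := by simpa [hSy] using hS.dotProduct_mulVec_pos hy0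
  have hsymm : ∀ p : ι → ℝ, y ⬝ᵥ S *ᵥ p = p ⬝ᵥ x := fun p => by
    have hT : Sᵀ = S := by simpa using hS.isHermitian.eq
    rw [dotProduct_mulVec, ← mulVec_transpose, hT, hSy, dotProduct_comm]
  refine ⟨(y ⬝ᵥ x)⁻¹, inv_pos.mpr hpos, fun p => ?_⟩
  set s := (p ⬝ᵥ x) / (y ⬝ᵥ x) with hs
  have h0 : 0 ≤ (p - s • y) ⬝ᵥ S *ᵥ (p - s • y) := by
    simpa using hS.posSemidef.dotProduct_mulVec_nonneg (p - s • y)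
  simp only [mulVec_sub, mulVec_smul, hSy, sub_dotProduct, dotProduct_sub, smul_dotProduct,
    dotProduct_smul, hsymm, smul_eq_mul] at h0
  have h1 : s * (y ⬝ᵥ x) = p ⬝ᵥ x := div_mul_cancel₀ _ hpos.ne'
  have h2 : (y ⬝ᵥ x)⁻¹ * (p ⬝ᵥ x) ^ 2 = s * (p ⬝ᵥ x) := by rw [hs]; ring
  rw [h2]
  rw [h1] at h0
  linarith

/-- A full-rank matrix with more columns than `γ` does not annihilate the left kernel of `γ`. -/
theorem Matrix.exists_transpose_mulVec_eq_zero_and_ne {d k s : ℕ} (γ : Matrix (Fin d) (Fin k) ℝ)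
    (δ : Matrix (Fin d) (Fin s) ℝ) (hδ : δ.rank = s) (hks : k < s) :
    ∃ u : Fin d → ℝ, γᵀ *ᵥ u = 0 ∧ ∃ a, (δᵀ *ᵥ u) a ≠ 0 := by
  by_contra! hcon
  have hle : LinearMap.ker γᵀ.mulVecLin ≤ LinearMap.ker δᵀ.mulVecLin := by
    intro u hu
    rw [LinearMap.mem_ker] at hu ⊢
    exact funext fun a => hcon u hu a
  have h1 := Submodule.finrank_mono hle
  have h2 := LinearMap.finrank_range_add_finrank_ker γᵀ.mulVecLin
  have h3 := LinearMap.finrank_range_add_finrank_ker δᵀ.mulVecLin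
  have h4 : Module.finrank ℝ (LinearMap.range δᵀ.mulVecLin) = s :=
    (rank_transpose δ).trans hδ
  have h5 : Module.finrank ℝ (LinearMap.range γᵀ.mulVecLin) ≤ k := by
    have := rank_le_height γᵀ; exact this
  omega

theorem Matrix.exists_ne_zero_transpose_mulVec_eq_zero {d k : ℕ} (φ : Matrix (Fin d) (Fin k) ℝ)
    (hkd : k < d) : ∃ w : Fin d → ℝ, w ≠ 0 ∧ φᵀ *ᵥ w = 0 := by
  -- With `δ = 1` the nonvanishing entry is one of `w` itself.
  obtain ⟨w, h, a, ha⟩ := φ.exists_transpose_mulVec_eq_zero_and_ne 1 (by simp) hkd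
  exact ⟨w, by rintro rfl; simp at ha, h⟩

end LinearAlgebra

/-! ### Processes bounded in mean square -/

section L2

variable {Ω : Type*} [MeasurableSpace Ω] {μ : Measure Ω}

/-- A scalar process of second order whose second moments are bounded over time. -/
structure IsL2Bounded (μ : Measure Ω) (Y : ℕ → Ω → ℝ) : Prop where
  memLp : ∀ t, MemLp (Y t) 2 μ
  bound : ∃ C : ℝ, ∀ t, ∫ ω, Y t ω ^ 2 ∂μ ≤ C

/-- The second moment is the lag-zero autocovariance plus the squared mean, a convergent sequence.
-/
theorem IsIZero.isL2Bounded [IsProbabilityMeasure μ] {Y : ℕ → Ω → ℝ} (h : IsIZero μ Y) :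
    IsL2Bounded μ Y := by
  refine ⟨h.memLp, ?_⟩
  obtain ⟨c, hc⟩ := h.mean
  obtain ⟨κ, hκ⟩ := h.autocov 0
  obtain ⟨C, hC⟩ := (hκ.add (hc.pow 2)).bddAbove_range
  refine ⟨C, fun t => le_trans (le_of_eq ?_) (hC ⟨t, rfl⟩)⟩
  simp only [add_zero]
  rw [covariance_self (h.memLp t).aemeasurable, variance_eq_sub (h.memLp t)]
  simp

theorem IsL2Bounded.congr {Y Z : ℕ → Ω → ℝ} (hY : IsL2Bounded μ Y) (h : ∀ t, Y t =ᵐ[μ] Z t) :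
    IsL2Bounded μ Z := by
  obtain ⟨C, hC⟩ := hY.bound
  refine ⟨fun t => (memLp_congr_ae (h t)).mp (hY.memLp t), C, fun t => le_trans (le_of_eq ?_) (hC t)⟩
  refine integral_congr_ae ?_
  filter_upwards [h t] with ω hω
  rw [hω]

theorem IsL2Bounded.sum {ι : Type*} [Fintype ι] {Y : ι → ℕ → Ω → ℝ}
    (hY : ∀ i, IsL2Bounded μ (Y i)) (c : ι → ℝ) :
    IsL2Bounded μ (fun t ω => ∑ i, Y i t ω * c i) := by
  choose C hC using fun i => (hY i).bound
  have hm : ∀ t, MemLp (fun ω => ∑ i, Y i t ω * c i) 2 μ := fun t =>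
    memLp_finsetSum _ fun i _ => ((hY i).memLp t).mul_const (c i)
  refine ⟨hm, Fintype.card ι * ∑ i, C i * c i ^ 2, fun t => ?_⟩
  have hint : ∀ i, Integrable (fun ω => Y i t ω ^ 2 * c i ^ 2) μ := fun i =>
    ((hY i).memLp t).integrable_sq.mul_const _
  calc ∫ ω, (∑ i, Y i t ω * c i) ^ 2 ∂μ
      ≤ ∫ ω, Fintype.card ι * ∑ i, Y i t ω ^ 2 * c i ^ 2 ∂μ := by
        refine integral_mono (hm t).integrable_sq
          ((integrable_finsetSum _ fun i _ => hint i).const_mul _) fun ω => ?_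
        have := sq_sum_le_card_mul_sum_sq (s := Finset.univ) (f := fun i => Y i t ω * c i)
        simpa [mul_pow] using this
    _ = Fintype.card ι * ∑ i, (∫ ω, Y i t ω ^ 2 ∂μ) * c i ^ 2 := by
        rw [integral_const_mul, integral_finsetSum _ fun i _ => hint i]
        simp_rw [integral_mul_const]
    _ ≤ _ := by
        gcongr with i
        exact hC i t

theorem IsL2Bounded.sub {Y Z : ℕ → Ω → ℝ} (hY : IsL2Bounded μ Y) (hZ : IsL2Bounded μ Z) :
    IsL2Bounded μ (fun t ω => Y t ω - Z t ω) := by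
  have := IsL2Bounded.sum (Y := fun i : Fin 2 => ![Y, Z] i)
    (fun i => by fin_cases i <;> simpa) ![1, -1]
  simpa [Fin.sum_univ_two, sub_eq_add_neg] using this

theorem MeasureTheory.MemLp.norm_toLp_sq {f : Ω → ℝ} (hf : MemLp f 2 μ) :
    ‖hf.toLp f‖ ^ 2 = ∫ ω, f ω ^ 2 ∂μ := by
  rw [← real_inner_self_eq_norm_sq, L2.inner_def]
  refine integral_congr_ae ?_
  filter_upwards [hf.coeFn_toLp] with ω hω
  rw [hω]; simp [sq]

/-- Square integrable combinations of a random vector, with bounded coefficients, are bounded in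
mean square, even if the vector itself is not square integrable. -/
theorem isL2Bounded_dotProduct {d : ℕ} (z : Ω → Fin d → ℝ) (q : ℕ → Fin d → ℝ)
    (hq : ∃ C : ℝ, ∀ t i, |q t i| ≤ C) (hm : ∀ t, MemLp (fun ω => q t ⬝ᵥ z ω) 2 μ) :
    IsL2Bounded μ (fun t ω => q t ⬝ᵥ z ω) := by
  -- The coefficients giving a square integrable combination form a finite-dimensional space, so the
  -- linear map from it to `L²` is automatically continuous.
  let V : Submodule ℝ (Fin d → ℝ) :=
    { carrier := {p | MemLp (fun ω => p ⬝ᵥ z ω) 2 μ}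
      zero_mem' := by simp
      add_mem' := fun {a b} ha hb => by
        have : MemLp (fun ω => a ⬝ᵥ z ω + b ⬝ᵥ z ω) 2 μ := MemLp.add ha hb
        simp only [← add_dotProduct] at this
        exact this
      smul_mem' := fun c a ha => by
        have : MemLp (fun ω => c • (a ⬝ᵥ z ω)) 2 μ := MemLp.const_smul ha c
        simp only [← smul_dotProduct] at this
        exact this }
  let T : V →ₗ[ℝ] Lp ℝ 2 μ :=
    { toFun := fun p => MemLp.toLp (fun ω => p.1 ⬝ᵥ z ω) p.2
      map_add' := fun a b => by
        rw [← MemLp.toLp_add]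
        exact MemLp.toLp_congr _ _ (ae_of_all _ fun ω => by simp [add_dotProduct])
      map_smul' := fun c a => by
        rw [RingHom.id_apply, ← MemLp.toLp_const_smul]
        exact MemLp.toLp_congr _ _ (ae_of_all _ fun ω => by simp [smul_dotProduct]) }
  obtain ⟨C, hC⟩ := hq
  refine ⟨hm, (‖LinearMap.toContinuousLinearMap T‖ * max C 0) ^ 2, fun t => ?_⟩
  rw [← (hm t).norm_toLp_sq]
  have h1 := (LinearMap.toContinuousLinearMap T).le_opNorm ⟨q t, hm t⟩
  have h2 : ‖(⟨q t, hm t⟩ : V)‖ ≤ max C 0 := by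
    change ‖q t‖ ≤ _
    rw [pi_norm_le_iff_of_nonneg (le_max_right _ _)]
    exact fun i => (hC t i).trans (le_max_left _ _)
  have h3 : ‖(hm t).toLp (fun ω => q t ⬝ᵥ z ω)‖ ≤ ‖LinearMap.toContinuousLinearMap T‖ * max C 0 :=
    h1.trans (mul_le_mul_of_nonneg_left h2 (norm_nonneg _))
  gcongr

end L2

/-! ### Accumulated noise -/

section Noise

variable {Ω : Type*} [MeasurableSpace Ω] {μ : Measure Ω} {m n : ℕ}
  {E : ℕ → Ω → Matrix (Fin m) (Fin n) ℝ} {S : Matrix (Fin n × Fin m) (Fin n × Fin m) ℝ}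

theorem IsMatrixWhiteNoise.memLp_dotProduct (hE : IsMatrixWhiteNoise μ E S) (t : ℕ)
    (p : Fin n × Fin m → ℝ) : MemLp (fun ω => p ⬝ᵥ vec (E t ω)) 2 μ :=
  memLp_finsetSum _ fun a _ => (hE.memLp t a.2 a.1).const_mul (p a)

variable [IsProbabilityMeasure μ]

theorem IsMatrixWhiteNoise.covariance_dotProduct (hE : IsMatrixWhiteNoise μ E S) (s t : ℕ)
    (p q : Fin n × Fin m → ℝ) :
    covariance (fun ω => p ⬝ᵥ vec (E s ω)) (fun ω => q ⬝ᵥ vec (E t ω)) μ =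
      if s = t then p ⬝ᵥ S *ᵥ q else 0 := by
  have h : covariance (fun ω => p ⬝ᵥ vec (E s ω)) (fun ω => q ⬝ᵥ vec (E t ω)) μ =
      ∑ a, ∑ b, p a * (q b *
        covariance (fun ω => vec (E s ω) a) (fun ω => vec (E t ω) b) μ) := by
    simp only [dotProduct]
    rw [covariance_fun_sum_fun_sum (X := fun a ω => p a * vec (E s ω) a)
      (Y := fun b ω => q b * vec (E t ω) b) (fun a => (hE.memLp s a.2 a.1).const_mul (p a))
      (fun b => (hE.memLp t b.2 b.1).const_mul (q b))]
    simp_rw [covariance_const_mul_left, covariance_const_mul_right]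
  rw [h]
  split_ifs with hst
  · subst hst
    simp only [hE.cov_same, dotProduct, mulVec, Finset.mul_sum]
    exact Finset.sum_congr rfl fun a _ => Finset.sum_congr rfl fun b _ => by ring
  · simp only [hE.cov_ne s t hst, mul_zero, Finset.sum_const_zero]

theorem IsMatrixWhiteNoise.not_isL2Bounded_sum (hE : IsMatrixWhiteNoise μ E S) (hS : S.PosDef)
    (p : ℕ → ℕ → Fin n × Fin m → ℝ) (x : Fin n × Fin m → ℝ) {κ : ℝ} (hκ : κ ≠ 0)
    (hp : ∀ t s, p t s ⬝ᵥ x = κ) :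
    ¬ IsL2Bounded μ (fun t ω => ∑ s ∈ Finset.range t, p t s ⬝ᵥ vec (E s ω)) := by
  intro hb
  obtain ⟨C, hC⟩ := hb.bound
  have hx : x ≠ 0 := by
    rintro rfl
    exact hκ (by simpa using (hp 0 0).symm)
  obtain ⟨c, hc, hle⟩ := hS.exists_mul_sq_dotProduct_le hx
  have hpos : 0 < c * κ ^ 2 := by positivity
  have hlow : ∀ t : ℕ, t * (c * κ ^ 2) ≤ C := fun t => by
    have h1 := variance_le_expectation_sq (hb.memLp t).aestronglyMeasurable
    rw [variance_fun_sum' fun s _ => hE.memLp_dotProduct s (p t s)] at h1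
    refine le_trans ?_ (h1.trans (hC t))
    simp_rw [hE.covariance_dotProduct]
    calc t * (c * κ ^ 2) = ∑ _s ∈ Finset.range t, c * κ ^ 2 := by simp
      _ ≤ _ := Finset.sum_le_sum fun s hs => by
        rw [Finset.sum_ite_eq, if_pos hs, ← hp t s]
        exact hle _
  obtain ⟨t, ht⟩ := exists_nat_gt (C / (c * κ ^ 2))
  rw [div_lt_iff₀ hpos] at ht
  exact absurd (hlow t) (not_le.mpr ht)

/-- A vector autoregression with stable unit roots, driven by linear images of a nondegenerate
matrix white noise, has no square-bounded linear combination outside the cointegration space. -/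
theorem not_isL2Bounded_of_unitRoot {d k : ℕ} {τ γ : Matrix (Fin d) (Fin k) ℝ}
    (hroot : HasStableUnitRoot (1 + τ * γᵀ) k) (hE : IsMatrixWhiteNoise μ E S) (hS : S.PosDef)
    (y e : ℕ → Ω → Fin d → ℝ)
    (hrec : ∀ t, ∀ᵐ ω ∂μ, y (t + 1) ω = (1 + τ * γᵀ) *ᵥ y t ω + e t ω)
    (L : (Fin d → ℝ) → Fin n × Fin m → ℝ)
    (hL : ∀ q t ω, q ⬝ᵥ e t ω = L q ⬝ᵥ vec (E t ω))
    (u v : Fin d → ℝ) (hu : γᵀ *ᵥ u = 0) (huv : v ⬝ᵥ u ≠ 0)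
    (x : Fin n × Fin m → ℝ) {c : ℝ} (hc : c ≠ 0) (hx : ∀ q, L q ⬝ᵥ x = c * (q ⬝ᵥ u)) :
    ¬ IsL2Bounded μ (fun t ω => v ⬝ᵥ y t ω) := by
  intro hb
  set A := 1 + τ * γᵀ with hA
  have hAu : ∀ t, A ^ t *ᵥ u = u := fun t => by
    induction t with
    | zero => simp
    | succ t ih =>
      rw [pow_succ, ← mulVec_mulVec, hA, add_mulVec, one_mulVec, ← mulVec_mulVec, hu, mulVec_zero,
        add_zero, ih]
  -- Quantifying over `q` inside the almost-sure event lets the induction replace `q` by `q ᵥ* A`.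
  -- The truncated exponent is harmless, since `s < t`.
  have hsol : ∀ t, ∀ᵐ ω ∂μ, ∀ q : Fin d → ℝ, q ⬝ᵥ y t ω = (q ᵥ* A ^ t) ⬝ᵥ y 0 ω +
      ∑ s ∈ Finset.range t, L (q ᵥ* A ^ (t - 1 - s)) ⬝ᵥ vec (E s ω) := fun t => by
    induction t with
    | zero => exact ae_of_all _ fun ω q => by simp
    | succ t ih =>
      filter_upwards [ih, hrec t] with ω h1 h2 q
      rw [h2, dotProduct_add, dotProduct_mulVec, h1, Finset.sum_range_succ, hL, vecMul_vecMul,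
        ← pow_succ', add_assoc]
      congr 2
      · refine Finset.sum_congr rfl fun s hs => ?_
        have := Finset.mem_range.mp hs
        rw [vecMul_vecMul, ← pow_succ', show t - 1 - s + 1 = t + 1 - 1 - s by omega]
      · simp
  have hnoise : ∀ t, MemLp (fun ω => ∑ s ∈ Finset.range t,
      L (v ᵥ* A ^ (t - 1 - s)) ⬝ᵥ vec (E s ω)) 2 μ := fun t =>
    memLp_finsetSum _ fun s _ => hE.memLp_dotProduct s _
  have hinit : IsL2Bounded μ (fun t ω => (v ᵥ* A ^ t) ⬝ᵥ y 0 ω) := by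
    refine isL2Bounded_dotProduct (y 0) (fun t => v ᵥ* A ^ t) ?_ fun t => ?_
    · obtain ⟨C, hC⟩ := hroot.exists_abs_pow_apply_le
      refine ⟨∑ i, |v i| * C, fun t j => ?_⟩
      rw [vecMul, dotProduct]
      refine (Finset.abs_sum_le_sum_abs _ _).trans (Finset.sum_le_sum fun i _ => ?_)
      rw [abs_mul]
      exact mul_le_mul_of_nonneg_left (hC t i j) (abs_nonneg _)
    -- No moment of `y 0` is assumed: this combination is square integrable as a difference of two
    -- such variables.
    · refine (memLp_congr_ae ?_).mp ((hb.memLp t).sub (hnoise t))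
      filter_upwards [hsol t] with ω hω
      simp [hω v]
  refine hE.not_isL2Bounded_sum hS (fun t s => L (v ᵥ* A ^ (t - 1 - s))) x (mul_ne_zero hc huv)
    (fun t s => ?_) ((hb.sub hinit).congr fun t => ?_)
  · rw [hx, ← dotProduct_mulVec, hAu]
  · filter_upwards [hsol t] with ω hω
    simp [hω v]

end Noise

/-! ### Cointegration ranks of an ECC-MAR process -/

section ECCMAR

variable {Ω : Type*} [MeasurableSpace Ω] {μ : Measure Ω}
  {m n r₁ r₂ : ℕ} {τ γ : Matrix (Fin m) (Fin r₁) ℝ} {φ θ : Matrix (Fin n) (Fin r₂) ℝ}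
  {S : Matrix (Fin n × Fin m) (Fin n × Fin m) ℝ} {X E : ℕ → Ω → Matrix (Fin m) (Fin n) ℝ}

theorem IsECCMAR.levels (hX : IsECCMAR μ τ γ φ θ S X E) (t : ℕ) :
    ∀ᵐ ω ∂μ, X (t + 1) ω = (1 + τ * γᵀ) * X t ω * (1 + φ * θᵀ)ᵀ + E (t + 1) ω := by
  filter_upwards [hX.error_correction t] with ω h
  rw [sub_eq_iff_eq_add.mp h]
  simp only [transpose_add, transpose_one, transpose_mul, transpose_transpose, Matrix.add_mul,
    Matrix.mul_add, Matrix.one_mul, Matrix.mul_one, Matrix.mul_assoc]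
  abel

variable [IsProbabilityMeasure μ]

theorem IsECCMAR.not_isIZero_left (hX : IsECCMAR μ τ γ φ θ S X E) (hS : S.PosDef) {s : ℕ}
    (hs : r₁ < s) (δ : Matrix (Fin m) (Fin s) ℝ) (hδ : δ.rank = s) :
    ¬ IsIZeroComponentwise μ (fun t ω => δᵀ * X t ω) := by
  intro h
  obtain ⟨u, hu, a, ha⟩ := γ.exists_transpose_mulVec_eq_zero_and_ne δ hδ hs
  obtain ⟨w, hw0, hw⟩ := φ.exists_ne_zero_transpose_mulVec_eq_zero hX.col_roots.lt
  have hww : w ⬝ᵥ w ≠ 0 := fun h0 => hw0 (dotProduct_self_eq_zero.mp h0)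
  have hfix : (1 + φ * θᵀ)ᵀ *ᵥ w = w := by
    rw [transpose_add, transpose_one, transpose_mul, transpose_transpose, add_mulVec, one_mulVec,
      ← mulVec_mulVec, hw, mulVec_zero, add_zero]
  refine not_isL2Bounded_of_unitRoot hX.row_roots hX.noise hS (fun t ω => X t ω *ᵥ w)
    -- The functional `q` acts on the noise through `w ⊗ q`, whose pairing with `w ⊗ u` is `(w ⬝ᵥ w)
    -- * (q ⬝ᵥ u)`.
    (fun t ω => E (t + 1) ω *ᵥ w) (fun t => ?_) (fun q b => q b.2 * w b.1) (fun q t ω => ?_) u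
    (fun i => δ i a) hu ha (fun b => u b.2 * w b.1) hww (fun q => ?_) ?_
  · filter_upwards [hX.levels t] with ω hω
    rw [hω, add_mulVec, ← mulVec_mulVec, hfix, mulVec_mulVec]
  · simp only [dotProduct, mulVec, Finset.mul_sum, Fintype.sum_prod_type_right, vec]
    exact Finset.sum_congr rfl fun i _ => Finset.sum_congr rfl fun j _ => by ring
  · simp only [dotProduct, Finset.sum_mul_sum, Fintype.sum_prod_type]
    exact Finset.sum_congr rfl fun i _ => Finset.sum_congr rfl fun j _ => by ring
  · have := IsL2Bounded.sum (fun j => (h a j).isL2Bounded) w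
    convert this using 3 with t ω
    rw [dotProduct_mulVec]
    rfl

theorem IsECCMAR.not_isIZero_right (hX : IsECCMAR μ τ γ φ θ S X E) (hS : S.PosDef) {s : ℕ}
    (hs : r₂ < s) (δ : Matrix (Fin n) (Fin s) ℝ) (hδ : δ.rank = s) :
    ¬ IsIZeroComponentwise μ (fun t ω => X t ω * δ) := by
  intro h
  obtain ⟨u, hu, a, ha⟩ := θ.exists_transpose_mulVec_eq_zero_and_ne δ hδ hs
  obtain ⟨w, hw0, hw⟩ := τ.exists_ne_zero_transpose_mulVec_eq_zero hX.row_roots.lt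
  have hww : w ⬝ᵥ w ≠ 0 := fun h0 => hw0 (dotProduct_self_eq_zero.mp h0)
  have hfix : w ᵥ* (1 + τ * γᵀ) = w := by
    rw [vecMul_add, vecMul_one, ← vecMul_vecMul, ← mulVec_transpose τ, hw, zero_vecMul, add_zero]
  refine not_isL2Bounded_of_unitRoot hX.col_roots hX.noise hS (fun t ω => w ᵥ* X t ω)
    (fun t ω => w ᵥ* E (t + 1) ω) (fun t => ?_) (fun q b => q b.1 * w b.2) (fun q t ω => ?_) u
    (fun i => δ i a) hu ha (fun b => u b.1 * w b.2) hww (fun q => ?_) ?_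
  · filter_upwards [hX.levels t] with ω hω
    rw [hω, vecMul_add, ← vecMul_vecMul, ← vecMul_vecMul, hfix, vecMul_transpose]
  · simp only [dotProduct, vecMul, Finset.mul_sum, Fintype.sum_prod_type, vec]
    exact Finset.sum_congr rfl fun i _ => Finset.sum_congr rfl fun j _ => by ring
  · simp only [dotProduct, Finset.sum_mul_sum, Fintype.sum_prod_type_right]
    exact Finset.sum_congr rfl fun i _ => Finset.sum_congr rfl fun j _ => by ring
  · have := IsL2Bounded.sum (fun i => (h i a).isL2Bounded) w
    convert this using 3 with t ω
    rw [dotProduct_comm, ← dotProduct_mulVec, dotProduct_comm]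
    rfl

end ECCMAR

theorem mainTheorem7 {Ω : Type*} [MeasurableSpace Ω] (μ : Measure Ω) [IsProbabilityMeasure μ]
    {m n r₁ r₂ : ℕ}
    (τ γ : Matrix (Fin m) (Fin r₁) ℝ) (φ θ : Matrix (Fin n) (Fin r₂) ℝ)
    (S : Matrix (Fin n × Fin m) (Fin n × Fin m) ℝ) (hS : S.PosDef)
    (X E : ℕ → Ω → Matrix (Fin m) (Fin n) ℝ)
    (hX : IsECCMAR μ τ γ φ θ S X E)
    (r : ℕ) (hr : (r : ℤ) = n * r₁ + m * r₂ - r₁ * r₂)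
    (s₁ s₂ : ℕ) (hs : (r : ℤ) = n * s₁ + m * s₂ - s₁ * s₂)
    (hne : (s₁, s₂) ≠ (r₁, r₂)) :
    (∀ γs : Matrix (Fin m) (Fin s₁) ℝ, γs.rank = s₁ →
        ¬ IsIZeroComponentwise μ (fun t ω => γsᵀ * X t ω)) ∨
    (∀ θs : Matrix (Fin n) (Fin s₂) ℝ, θs.rank = s₂ →
        ¬ IsIZeroComponentwise μ (fun t ω => X t ω * θs)) := by

  have hm : (r₁ : ℤ) < m := by exact_mod_cast hX.row_roots.lt
  have hn : (r₂ : ℤ) < n := by exact_mod_cast hX.col_roots.lt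
  rcases lt_or_ge r₁ s₁ with h1 | h1
  · exact Or.inl fun γs hγs => hX.not_isIZero_left hS h1 γs hγs
  rcases lt_or_ge r₂ s₂ with h2 | h2
  · exact Or.inr fun θs hθs => hX.not_isIZero_right hS h2 θs hθs
  exfalso
  have h1' : (s₁ : ℤ) ≤ r₁ := by exact_mod_cast h1
  have h2' : (s₂ : ℤ) ≤ r₂ := by exact_mod_cast h2
  -- The difference of the two rank identities, split into two nonnegative products with `n - r₂`
  -- and `m - s₁` positive.
  have hsum : ((n : ℤ) - r₂) * (r₁ - s₁) + (m - s₁) * (r₂ - s₂) = 0 := by linarith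
  have e1 : 0 ≤ ((n : ℤ) - r₂) * (r₁ - s₁) := mul_nonneg (by linarith) (by linarith)
  have e2 : 0 ≤ ((m : ℤ) - s₁) * (r₂ - s₂) := mul_nonneg (by linarith) (by linarith)
  have f1 : (r₁ : ℤ) - s₁ = 0 :=
    (mul_eq_zero.mp (le_antisymm (by linarith) e1)).resolve_left (by linarith)
  have f2 : (r₂ : ℤ) - s₂ = 0 :=
    (mul_eq_zero.mp (le_antisymm (by linarith) e2)).resolve_left (by linarith)
  exact hne (Prod.ext (by push_cast; omega) (by push_cast; omega))
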